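/- Let $\varphi_a:0\mapsto 0,\,1\mapsto 10$; $\varphi_b:0\mapsto 0,\,1\mapsto 01$; $\varphi_\alpha:0\mapsto 01,\,1\mapsto 1$; $\varphi_\beta:0\mapsto 10,\,1\mapsto 1$ be morphisms of $\{0,1\}^*$, and for $w=w_0\cdots w_{n-1}\in\{a,b,\alpha,\beta\}^*$ put $\varphi_w=\varphi_{w_0}\circ\cdots\circ\varphi_{w_{n-1}}$. Let $N(w)$ be the lexicographically greatest word (with $a<b$, $\alpha<\beta$) that can be obtained from $w$ by replacing factors according to the rules $\alpha a^k\beta=\beta b^k\alpha$ and $a\alpha^kb=b\beta^ka$ ($k\ge 0$), in either direction; the rules preserve the positions of the Latin and of the Greek letters. If $\psi=\varphi_v$, then $N(v)$ is called the normalized name of $\psi$. A normalized name $w\notin\{a,\alpha\}^*$ has a prefix $a^k\beta$ or $\alpha^kb$ with $k\ge 0$, and one puts $\Delta(w)=N(w'a^k\beta)$ if $w=a^k\beta w'$ and $\Delta(w)=N(w'\alpha^kb)$ if $w=\alpha^kbw'$; for $\psi=\varphi_w$ one puts $\Delta^j(\psi)=\varphi_{\Delta^j(w)}$. For a prefix $p$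 of an infinite word $\mathbf u$, let $i_0=0<i_1<i_2<\cdots$ be all the occurrences of $p$ in $\mathbf u$, assumed infinite in number. The words $\mathbf u_{i_n}\mathbf u_{i_n+1}\cdots \mathbf u_{i_{n+1}-1}$ are the return words to $p$, and the derivated word of $\mathbf u$ with respect to $p$ is the infinite word that codes the sequence of these return words for $n=0,1,2,\dots$, with one letter for each return word; it is defined up to a bijective renaming of letters. **Theorem 3.3.** Let $\psi\in\langle\varphi_a,\varphi_b,\varphi_\alpha,\varphi_\beta\rangle$ be a primitive morphism whose normalized name does not belong to $\{a,\alpha\}^*$. Then $\psi$ has exactly one fixed point $\mathbf u\in\{0,1\}^{\mathbb N}$, and each $\Delta^j(\psi)$, $j\ge 1$, has exactly one fixed point in $\{0,1\}^{\mathbb N}$. The word $\mathbf u$ is uniformly recurrent (every prefix of $\mathbf u$ occurs infinitely often in $\mathbf u$ and has finitely many return words). Moreover, an infinite word $\mathbf x$ (over any alphabet) is, up to a bijective renaming of letters, the derivated word of $\mathbf u$ with respect to some nonempty prefix of $\mathbf u$ if and only if $\mathbf x$ is, up to a bijective renaming of letters, the fixed point of $\Delta^j(\psi)$ for some $j\ge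 1$. -/

import Mathlib

namespace Sturmian

/-! ### Words and morphisms -/

section Words

variable {A B : Type*}

/-- The factor `u_i u_{i+1} ⋯ u_{i+n-1}` of length `n` of the infinite word `u`. -/
def factor (u : ℕ → A) (i n : ℕ) : List A :=
  (List.range n).map fun k => u (i + k)

/-- `i` is an occurrence of the finite word `w` in the infinite word `u`. -/
def Occurs (u : ℕ → A) (w : List A) (i : ℕ) : Prop :=
  factor u i w.length = w

/-- `w` is a prefix of the infinite word `u`. -/
def IsPrefixOf (w : List A) (u : ℕ → A) : Prop :=
  Occurs u w 0

/-- The set of return words to `w` in `u`: the words `u_i ⋯ u_{j-1}`, where `i < j` are two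
consecutive occurrences of `w` in `u`. -/
def returnWords (u : ℕ → A) (w : List A) : Set (List A) :=
  {r | ∃ i j : ℕ, i < j ∧ Occurs u w i ∧ Occurs u w j ∧
    (∀ k, i < k → k < j → ¬ Occurs u w k) ∧ r = factor u i (j - i)}

/-- The `n`-th return word (`n = 0, 1, …`) met when `u` is cut at the successive occurrences of
`w`. It is meaningful when `w` occurs infinitely often in `u`. -/
noncomputable def nthReturnWord (u : ℕ → A) (w : List A) (n : ℕ) : List A :=
  factor u (Nat.nth (Occurs u w) n) (Nat.nth (Occurs u w) (n + 1) - Nat.nth (Occurs u w) n)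

/-- `x` is a derivated word `d_u(w)` of `u` with respect to `w`: the word `w` occurs infinitely
often in `u`, and, for some naming `r` of the return words to `w` by the letters of the alphabet
`B` (one letter for each return word), `u` is cut by the occurrences of `w` into
`r_{x_0} r_{x_1} r_{x_2} ⋯`. As the naming is free, this determines `x` exactly up to a bijective
renaming of the letters. -/
def IsDerivatedWord (u : ℕ → A) (w : List A) (x : ℕ → B) : Prop :=
  {i | Occurs u w i}.Infinite ∧
    ∃ r : B ≃ returnWords u w, ∀ n, nthReturnWord u w n = (r (x n) : List A)

/-- Every prefix of `u` occurs infinitely often in `u` and has finitely many return words. -/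
def UniformlyRecurrent (u : ℕ → A) : Prop :=
  ∀ w : List A, IsPrefixOf w u → {i | Occurs u w i}.Infinite ∧ (returnWords u w).Finite

/-- The two infinite words coincide up to a bijective renaming of letters. -/
def EqUpToLetters (x : ℕ → A) (y : ℕ → B) : Prop :=
  ∃ π : A ≃ B, ∀ n, y n = π (x n)

/-- `v = ψ(u) = ψ(u_0)ψ(u_1)ψ(u_2)⋯` for infinite words `u` and `v`: the images of the prefixes of
`u` are prefixes of `v`, of unbounded length. -/
def IsImage (ψ : Monoid.End (FreeMonoid A)) (u v : ℕ → A) : Prop :=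
  (∀ n, IsPrefixOf (ψ (FreeMonoid.ofList (factor u 0 n))).toList v) ∧
    ∀ m, ∃ n, m ≤ (ψ (FreeMonoid.ofList (factor u 0 n))).toList.length

/-- The infinite word `u` is a fixed point of the morphism `ψ`. -/
def IsFixedPoint (ψ : Monoid.End (FreeMonoid A)) (u : ℕ → A) : Prop :=
  IsImage ψ u u

/-- Some positive power of `ψ` maps each letter to a word containing all letters. -/
def IsPrimitive (ψ : Monoid.End (FreeMonoid A)) : Prop :=
  ∃ k : ℕ, 0 < k ∧ ∀ a b : A, a ∈ ((ψ ^ k) (FreeMonoid.of b)).toList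

end Words

/-! ### The special Sturmian monoid -/

/-- The four letters `a, b, α, β` in which names of morphisms are written. -/
inductive Name
  | a
  | b
  | α
  | β
  deriving DecidableEq

/-- The four elementary Sturmian morphisms `φ_a, φ_b, φ_α, φ_β` over the alphabet `{0, 1}`. -/
def elementary : Name → Monoid.End (FreeMonoid (Fin 2))
  | .a => FreeMonoid.lift ![FreeMonoid.ofList [0], FreeMonoid.ofList [1, 0]]
  | .b => FreeMonoid.lift ![FreeMonoid.ofList [0], FreeMonoid.ofList [0, 1]]
  | .α => FreeMonoid.lift ![FreeMonoid.ofList [0, 1], FreeMonoid.ofList [1]]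
  | .β => FreeMonoid.lift ![FreeMonoid.ofList [1, 0], FreeMonoid.ofList [1]]

/-- The special Sturmian monoid `⟨φ_a, φ_b, φ_α, φ_β⟩` (the product is composition). -/
def specialSturmianMonoid : Submonoid (Monoid.End (FreeMonoid (Fin 2))) :=
  Submonoid.closure (Set.range elementary)

/-- `φ_w = φ_{w_0} ∘ φ_{w_1} ∘ ⋯ ∘ φ_{w_{n-1}}`. -/
def phi (w : List Name) : Monoid.End (FreeMonoid (Fin 2)) :=
  (w.map elementary).prod

/-! ### Normalized names -/

/-- One application, inside a word, of one of the rules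
`α a^k β → β b^k α` and `a α^k b → b β^k a`. -/
inductive Step : List Name → List Name → Prop
  | greek (p s : List Name) (k : ℕ) :
      Step (p ++ ([.α] ++ List.replicate k .a ++ [.β]) ++ s)
        (p ++ ([.β] ++ List.replicate k .b ++ [.α]) ++ s)
  | latin (p s : List Name) (k : ℕ) :
      Step (p ++ ([.a] ++ List.replicate k .α ++ [.b]) ++ s)
        (p ++ ([.b] ++ List.replicate k .β ++ [.a]) ++ s)

/-- `v` can be obtained from `w` by applying the rewriting rules (in both directions). -/
def Rewrites (w v : List Name) : Prop :=
  Relation.EqvGen Step w v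

/-- The rank of a letter in the order `a < b < α < β`. -/
def Name.rank : Name → ℕ
  | .a => 0
  | .b => 1
  | .α => 2
  | .β => 3

theorem Name.rank_injective : Function.Injective Name.rank := by
  intro x y h
  cases x <;> cases y <;> simp_all [Name.rank]

/-- The order on the letters, with `a < b` and `α < β`. The rules preserve the positions of Latin
and of Greek letters, so that the comparison of a Latin letter with a Greek one is immaterial. -/
instance : LinearOrder Name :=
  LinearOrder.lift' Name.rank Name.rank_injective

theorem Rewrites.length_eq {w v : List Name} (h : Rewrites w v) : w.length = v.length := by
  induction h with
  | rel x y h => cases h <;> simp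
  | refl x => rfl
  | symm x y _ ih => exact ih.symm
  | trans x y z _ _ ih₁ ih₂ => exact ih₁.trans ih₂

theorem exists_isGreatest_rewrites (w : List Name) : ∃ v, IsGreatest {v | Rewrites w v} v := by
  have : Finite Name := Finite.of_injective
    (fun x : Name => (⟨x.rank, by cases x <;> decide⟩ : Fin 4))
    (fun x y h => Name.rank_injective (by simpa using h))
  have hfin : {v | Rewrites w v}.Finite :=
    (List.finite_length_eq Name w.length).subset fun v hv => (Rewrites.length_eq hv).symm
  obtain ⟨v, hv⟩ := hfin.exists_maximal ⟨w, Relation.EqvGen.refl w⟩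
  exact ⟨v, hv.1, fun y hy => (le_total y v).elim id fun h => hv.2 hy h⟩

/-- `N(w)`: the lexicographically greatest word obtained from `w` by the rewriting rules. -/
noncomputable def normalName (w : List Name) : List Name :=
  (exists_isGreatest_rewrites w).choose

theorem normalName_spec (w : List Name) : IsGreatest {v | Rewrites w v} (normalName w) :=
  (exists_isGreatest_rewrites w).choose_spec

/-- `w` is the normalized name of the morphism `ψ`: `w = N(v)` for a word `v` with `ψ = φ_v`. -/
def IsNormalizedName (ψ : Monoid.End (FreeMonoid (Fin 2))) (w : List Name) : Prop :=
  ∃ v : List Name, phi v = ψ ∧ normalName v = w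

/-- The operation `Δ` on normalized names outside `{a, α}*`:
`Δ(a^k β w') = N(w' a^k β)` and `Δ(α^k b w') = N(w' α^k b)`.
(The last case, `Δ(w) = w`, does not arise for such names.) -/
noncomputable def delta (w : List Name) : List Name :=
  match w.dropWhile (· = .a) with
  | .β :: w' => normalName (w' ++ w.takeWhile (· = .a) ++ [.β])
  | _ =>
    match w.dropWhile (· = .α) with
    | .b :: w' => normalName (w' ++ w.takeWhile (· = .α) ++ [.b])
    | _ => w

end Sturmian

/-! A normalized name is irreducible: every rule, read from left to right, increases the word
lexicographically. An irreducible name outside `{a, α}*` therefore starts with `a^k β` or `α^k b`,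
and these prefixes name the morphisms `block c k : c ↦ c d^k, d ↦ c d^(k+1)`, with `c = 1` or `c =
0`. So `ψ = F ∘ G` with `F = block c k`, and `Δ` passes to the conjugate `G ∘ F`. If `u` is fixed by
`F ∘ G`, then `u = F(u')` with `u'` fixed by `G ∘ F`.

In `u = F(u')` the letter `c` marks exactly the block starts. A nonempty prefix `p` of `u` starts
with `c`, and its occurrences are the block starts at the occurrences of a strictly shorter prefix
`q` of `u'` (`occurs_iff_exists_blockPos`). The return words to `p` are then the images under the
injective `F` of those to `q`, and the derivated words with respect to `p` and `q` agree
(`isDerivatedWord_iff`). Induction on the length of `p` ends at the empty prefix, whose derivated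
word is the fixed point itself. Conversely every prefix `q` of `u'` arises from some `p`, and
induction on `j` realizes every `Δ^j(ψ)`. Uniform recurrence follows by the same descent.

Primitivity survives conjugation because each letter occurs in its own image. It makes all letters
occur in the fixed points and, since `F ∘ G` sends every letter to a word starting with `c`, forces
existence and uniqueness of the fixed point. -/

namespace Sturmian

/-! ### Factors and prefixes of infinite words -/

section Factor

variable {A : Type*}

@[simp]
theorem length_factor (u : ℕ → A) (i n : ℕ) : (factor u i n).length = n := by
  simp [factor]

@[simp]
theorem getElem_factor (u : ℕ → A) (i n k : ℕ) (h : k < (factor u i n).length) :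
    (factor u i n)[k] = u (i + k) := by
  simp [factor]

@[simp]
theorem factor_zero (u : ℕ → A) (i : ℕ) : factor u i 0 = [] := rfl

theorem factor_one (u : ℕ → A) (i : ℕ) : factor u i 1 = [u i] := by
  simp [factor]

theorem factor_add (u : ℕ → A) (i m n : ℕ) :
    factor u i (m + n) = factor u i m ++ factor u (i + m) n := by
  simp [factor, List.range_add, Function.comp_def, add_assoc]

theorem factor_prefix_factor (u : ℕ → A) (i : ℕ) {m n : ℕ} (h : m ≤ n) :
    factor u i m <+: factor u i n := by
  obtain ⟨k, rfl⟩ := Nat.exists_eq_add_of_le h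
  exact ⟨_, (factor_add u i m k).symm⟩

theorem factor_eq_factor_iff (u v : ℕ → A) (i j n : ℕ) :
    factor u i n = factor v j n ↔ ∀ k < n, u (i + k) = v (j + k) := by
  simp [factor]

theorem occurs_factor_iff (u : ℕ → A) (n i : ℕ) :
    Occurs u (factor u 0 n) i ↔ ∀ k < n, u (i + k) = u k := by
  simp [Occurs, factor_eq_factor_iff]

theorem isPrefixOf_factor (u : ℕ → A) (n : ℕ) : IsPrefixOf (factor u 0 n) u := by
  simp [IsPrefixOf, Occurs]

theorem IsPrefixOf.of_prefix {w w' : List A} {u : ℕ → A} (h : IsPrefixOf w' u) (hw : w <+: w') :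
    IsPrefixOf w u := by
  obtain ⟨t, rfl⟩ := hw
  unfold IsPrefixOf Occurs at h ⊢
  rw [List.length_append, factor_add] at h
  exact (List.append_inj h (by simp)).1

theorem IsPrefixOf.apply_eq {w : List A} {u : ℕ → A} (h : IsPrefixOf w u) (n : ℕ)
    (hn : n < w.length) : u n = w[n] := by
  unfold IsPrefixOf Occurs at h
  conv_rhs => rw [List.getElem_of_eq h.symm hn]
  simp

theorem isPrefixOf_of_apply_eq {w : List A} {u : ℕ → A}
    (h : ∀ n (hn : n < w.length), u n = w[n]) : IsPrefixOf w u := by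
  refine List.ext_getElem (by simp) fun n h₁ h₂ => ?_
  simpa using h n h₂

theorem factor_prefix_of_isPrefixOf {w : List A} {u : ℕ → A} (h : IsPrefixOf w u) {n : ℕ}
    (hn : n ≤ w.length) : factor u 0 n <+: w := by
  rw [← show factor u 0 w.length = w from h]
  exact factor_prefix_factor u 0 hn

theorem occurs_nil (u : ℕ → A) (i : ℕ) : Occurs u [] i := rfl

end Factor

/-! ### Images of infinite words and fixed points -/

section Images

variable {A : Type*}

/-- The image of a finite word, given as a list, under a morphism. -/
def mapWord (ψ : Monoid.End (FreeMonoid A)) (l : List A) : List A :=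
  (ψ (FreeMonoid.ofList l)).toList

@[simp]
theorem mapWord_nil (ψ : Monoid.End (FreeMonoid A)) : mapWord ψ [] = [] := by
  simp [mapWord]

@[simp]
theorem mapWord_append (ψ : Monoid.End (FreeMonoid A)) (l m : List A) :
    mapWord ψ (l ++ m) = mapWord ψ l ++ mapWord ψ m := by
  simp [mapWord, FreeMonoid.ofList_append, FreeMonoid.toList_mul]

theorem mapWord_cons (ψ : Monoid.End (FreeMonoid A)) (e : A) (l : List A) :
    mapWord ψ (e :: l) = mapWord ψ [e] ++ mapWord ψ l := by
  rw [← mapWord_append, List.singleton_append]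

theorem mapWord_mul (ψ φ : Monoid.End (FreeMonoid A)) (l : List A) :
    mapWord (ψ * φ) l = mapWord ψ (mapWord φ l) := rfl

@[simp]
theorem mapWord_one (l : List A) : mapWord (1 : Monoid.End (FreeMonoid A)) l = l := rfl

theorem mapWord_prefix (ψ : Monoid.End (FreeMonoid A)) {l m : List A} (h : l <+: m) :
    mapWord ψ l <+: mapWord ψ m := by
  obtain ⟨t, rfl⟩ := h
  simp

theorem mem_mapWord {ψ : Monoid.End (FreeMonoid A)} {l : List A} {x : A} :
    x ∈ mapWord ψ l ↔ ∃ e ∈ l, x ∈ mapWord ψ [e] := by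
  induction l with
  | nil => simp
  | cons e l ih => rw [mapWord_cons, List.mem_append, ih]; simp

/-- No letter has an empty image. -/
def Nonerasing (ψ : Monoid.End (FreeMonoid A)) : Prop :=
  ∀ e, mapWord ψ [e] ≠ []

theorem Nonerasing.length_le {ψ : Monoid.End (FreeMonoid A)} (h : Nonerasing ψ) (l : List A) :
    l.length ≤ (mapWord ψ l).length := by
  induction l with
  | nil => simp
  | cons e l ih =>
    rw [mapWord_cons, List.length_append, List.length_cons]
    have := List.length_pos_iff.2 (h e)
    omega

theorem isImage_iff {ψ : Monoid.End (FreeMonoid A)} {u v : ℕ → A} :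
    IsImage ψ u v ↔ (∀ n, IsPrefixOf (mapWord ψ (factor u 0 n)) v) ∧
      ∀ m, ∃ n, m ≤ (mapWord ψ (factor u 0 n)).length := Iff.rfl

theorem Nonerasing.isImage_iff {ψ : Monoid.End (FreeMonoid A)} (h : Nonerasing ψ) {u v : ℕ → A} :
    IsImage ψ u v ↔ ∀ n, IsPrefixOf (mapWord ψ (factor u 0 n)) v :=
  ⟨fun H => H.1, fun H => ⟨H, fun m => ⟨m, (length_factor u 0 m).symm.trans_le
    (h.length_le (factor u 0 m))⟩⟩⟩

theorem IsImage.unique {ψ : Monoid.End (FreeMonoid A)} {u v v' : ℕ → A} (h : IsImage ψ u v)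
    (h' : IsImage ψ u v') : v = v' := by
  rw [Sturmian.isImage_iff] at h h'
  funext n
  obtain ⟨m, hm⟩ := h.2 (n + 1)
  rw [(h.1 m).apply_eq n hm, (h'.1 m).apply_eq n hm]

theorem IsImage.comp {ψ φ : Monoid.End (FreeMonoid A)} {u v w : ℕ → A} (h : IsImage φ u v)
    (h' : IsImage ψ v w) : IsImage (ψ * φ) u w := by
  rw [Sturmian.isImage_iff] at h h' ⊢
  refine ⟨fun n => ?_, fun m => ?_⟩
  · rw [mapWord_mul, ← show factor v 0 _ = _ from h.1 n]
    exact h'.1 _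
  · obtain ⟨n', hn'⟩ := h'.2 m
    obtain ⟨n, hn⟩ := h.2 n'
    refine ⟨n, hn'.trans ?_⟩
    rw [mapWord_mul]
    exact (mapWord_prefix ψ (factor_prefix_of_isPrefixOf (h.1 n) hn)).length_le

theorem Nonerasing.exists_isImage {ψ : Monoid.End (FreeMonoid A)} (h : Nonerasing ψ)
    (u : ℕ → A) : ∃ v, IsImage ψ u v := by
  have hlen : ∀ n, n < (mapWord ψ (factor u 0 (n + 1))).length := fun n => by
    simpa using h.length_le (factor u 0 (n + 1))
  refine ⟨fun n => (mapWord ψ (factor u 0 (n + 1)))[n]'(hlen n), h.isImage_iff.2 fun n =>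
    isPrefixOf_of_apply_eq fun m hm => ?_⟩
  rcases le_total (m + 1) n with hmn | hmn
  · exact (mapWord_prefix ψ (factor_prefix_factor u 0 hmn)).getElem (hlen m)
  · exact ((mapWord_prefix ψ (factor_prefix_factor u 0 hmn)).getElem hm).symm

theorem IsFixedPoint.pow {ψ : Monoid.End (FreeMonoid A)} {u : ℕ → A} (h : IsFixedPoint ψ u)
    (n : ℕ) : IsFixedPoint (ψ ^ n) u := by
  induction n with
  | zero => exact ⟨fun n => isPrefixOf_factor u n, fun m => ⟨m, by simp⟩⟩
  | succ n ih => rw [pow_succ]; exact IsImage.comp h ih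

/-- A fixed point of `F ∘ G` is the image under `F` of a fixed point of `G ∘ F`. -/
theorem IsFixedPoint.exists_conj {F G : Monoid.End (FreeMonoid A)} (hF : Nonerasing F)
    (hG : Nonerasing G) {u : ℕ → A} (h : IsFixedPoint (F * G) u) :
    ∃ u', IsFixedPoint (G * F) u' ∧ IsImage F u' u := by
  obtain ⟨u', hu'⟩ := hG.exists_isImage u
  obtain ⟨v, hv⟩ := hF.exists_isImage u'
  -- Both `v` and `u` are the image of `u` under `F * G`.
  obtain rfl : v = u := (hu'.comp hv).unique h
  exact ⟨u', hv.comp hu', hv⟩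

theorem IsImage.isPrefixOf_head {ψ : Monoid.End (FreeMonoid A)} {u v : ℕ → A}
    (h : IsImage ψ u v) : IsPrefixOf (mapWord ψ [u 0]) v := by
  simpa [factor_one, mapWord] using h.1 1

/-- The words `ψ^n(c)` are nested prefixes, each strictly longer than the previous one, so they
converge to an infinite word; any fixed point starting with `c` has all of them as prefixes. -/
theorem existsUnique_isFixedPoint {ψ : Monoid.End (FreeMonoid A)} (hψ : Nonerasing ψ) {c : A}
    {s : List A} (hs : s ≠ []) (hc : mapWord ψ [c] = c :: s) :
    ∃! u, IsFixedPoint ψ u ∧ u 0 = c := by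
  have hne : ∀ n, Nonerasing (ψ ^ n) := by
    intro n
    induction n with
    | zero => intro e; simp
    | succ n ih =>
      intro e he
      rw [pow_succ', mapWord_mul, ← List.length_eq_zero_iff] at he
      have h₁ := hψ.length_le (mapWord (ψ ^ n) [e])
      exact ih e (List.length_eq_zero_iff.1 (by omega))
  have hstep : ∀ n, mapWord (ψ ^ (n + 1)) [c] = mapWord (ψ ^ n) [c] ++ mapWord (ψ ^ n) s := by
    intro n
    rw [pow_succ, mapWord_mul, hc, mapWord_cons]
  have hpre : ∀ m n, m ≤ n → mapWord (ψ ^ m) [c] <+: mapWord (ψ ^ n) [c] := by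
    intro m n hmn
    induction n, hmn using Nat.le_induction with
    | base => exact List.prefix_rfl
    | succ n _ ih => exact ih.trans ⟨_, (hstep n).symm⟩
  have hlen : ∀ n, n < (mapWord (ψ ^ n) [c]).length := by
    intro n
    induction n with
    | zero => simp
    | succ n ih =>
      rw [hstep, List.length_append]
      have := (hne n).length_le s
      have := List.length_pos_iff.2 hs
      omega
  refine ⟨fun n => (mapWord (ψ ^ n) [c])[n]'(hlen n), ⟨?_, by simp⟩, ?_⟩
  · have hp : ∀ n, IsPrefixOf (mapWord (ψ ^ n) [c])
        (fun n => (mapWord (ψ ^ n) [c])[n]'(hlen n)) := by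
      refine fun n => isPrefixOf_of_apply_eq fun m hm => ?_
      rcases le_total m n with hmn | hmn
      · exact (hpre _ _ hmn).getElem (hlen m)
      · exact ((hpre _ _ hmn).getElem hm).symm
    refine hψ.isImage_iff.2 fun n => (hp (n + 1)).of_prefix ?_
    rw [pow_succ', mapWord_mul]
    exact mapWord_prefix ψ (factor_prefix_of_isPrefixOf (hp n) (hlen n).le)
  · rintro v ⟨hv, rfl⟩
    funext n
    exact (hv.pow n).isPrefixOf_head.apply_eq n (hlen n)

end Images

/-! ### Transport of return words along a substitution -/

section Transport

variable {A B : Type*} {u u' : ℕ → A} {p q : List A} {pos : ℕ → ℕ} {f : List A → List A}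

/-- In the application, `pos m` is the place where the image of `u'_m` starts in `u`, and `f` is the
action of the substitution on finite words. -/
theorem setOf_occurs_infinite_iff (hpos : StrictMono pos)
    (hocc : ∀ i, Occurs u p i ↔ ∃ m, pos m = i ∧ Occurs u' q m) :
    {i | Occurs u p i}.Infinite ↔ {i | Occurs u' q i}.Infinite := by
  have : {i | Occurs u p i} = pos '' {i | Occurs u' q i} := by
    ext i
    simp only [Set.mem_ofPred_eq, Set.mem_image, hocc]
    exact exists_congr fun m => and_comm
  rw [this, Set.infinite_image_iff hpos.injective.injOn]

theorem returnWords_eq_image (hpos : StrictMono pos)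
    (hocc : ∀ i, Occurs u p i ↔ ∃ m, pos m = i ∧ Occurs u' q m)
    (hfac : ∀ i j, i ≤ j → factor u (pos i) (pos j - pos i) = f (factor u' i (j - i))) :
    returnWords u p = f '' returnWords u' q := by
  have hocc' : ∀ m, Occurs u p (pos m) ↔ Occurs u' q m := fun m => by
    rw [hocc]
    exact ⟨fun ⟨m', h, h'⟩ => hpos.injective h ▸ h', fun h => ⟨m, rfl, h⟩⟩
  ext r
  constructor
  · rintro ⟨i, j, hij, hi, hj, hk, rfl⟩
    obtain ⟨i, rfl, hi'⟩ := (hocc _).1 hi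
    obtain ⟨j, rfl, hj'⟩ := (hocc _).1 hj
    have hij' := hpos.lt_iff_lt.1 hij
    exact ⟨_, ⟨i, j, hij', hi', hj', fun k h₁ h₂ h₃ => hk (pos k) (hpos h₁) (hpos h₂)
      ((hocc' k).2 h₃), rfl⟩, (hfac i j hij'.le).symm⟩
  · rintro ⟨_, ⟨i, j, hij, hi, hj, hk, rfl⟩, rfl⟩
    refine ⟨pos i, pos j, hpos hij, (hocc' i).2 hi, (hocc' j).2 hj, fun k h₁ h₂ h₃ => ?_,
      (hfac i j hij.le).symm⟩
    obtain ⟨k, rfl, hk'⟩ := (hocc _).1 h₃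
    exact hk k (hpos.lt_iff_lt.1 h₁) (hpos.lt_iff_lt.1 h₂) hk'

theorem nthReturnWord_eq (hpos : StrictMono pos)
    (hocc : ∀ i, Occurs u p i ↔ ∃ m, pos m = i ∧ Occurs u' q m)
    (hfac : ∀ i j, i ≤ j → factor u (pos i) (pos j - pos i) = f (factor u' i (j - i)))
    (hinf : {i | Occurs u p i}.Infinite) (n : ℕ) :
    nthReturnWord u p n = f (nthReturnWord u' q n) := by
  have hocc' : (fun m => Occurs u p (pos m)) = Occurs u' q := by
    funext m
    rw [hocc]
    exact propext ⟨fun ⟨m', h, h'⟩ => hpos.injective h ▸ h', fun h => ⟨m, rfl, h⟩⟩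
  have hnth : ∀ n, Nat.nth (Occurs u p) n = pos (Nat.nth (Occurs u' q) n) := fun n => by
    rw [← hocc']
    -- With infinitely many occurrences, `Nat.nth` never takes its default value, so the side
    -- condition for finite sets is void.
    refine (Nat.nth_comp_of_strictMono hpos (fun k hk => ?_) fun h => absurd h hinf).symm
    obtain ⟨m, hm, -⟩ := (hocc k).1 hk
    exact ⟨m, hm⟩
  rw [nthReturnWord, nthReturnWord, hnth, hnth, hfac]
  exact Nat.nth_monotone ((setOf_occurs_infinite_iff hpos hocc).1 hinf) n.le_succ

/-- Injectivity of `f` gives a bijection between the two sets of return words, along which a naming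
by letters is carried over in either direction. -/
theorem isDerivatedWord_iff (hf : Function.Injective f) (hpos : StrictMono pos)
    (hocc : ∀ i, Occurs u p i ↔ ∃ m, pos m = i ∧ Occurs u' q m)
    (hfac : ∀ i j, i ≤ j → factor u (pos i) (pos j - pos i) = f (factor u' i (j - i)))
    (x : ℕ → B) : IsDerivatedWord u p x ↔ IsDerivatedWord u' q x := by
  have hret := returnWords_eq_image hpos hocc hfac
  refine and_congr_right_iff.2 (fun hinf => ?_) |>.trans
    (and_congr_left' (setOf_occurs_infinite_iff hpos hocc))
  let e : returnWords u' q ≃ returnWords u p :=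
    (Equiv.Set.image f _ hf).trans (Equiv.setCongr hret.symm)
  have he : ∀ r, (e r : List A) = f r := fun r => rfl
  constructor
  · rintro ⟨r, hr⟩
    refine ⟨r.trans e.symm, fun n => hf ?_⟩
    rw [← nthReturnWord_eq hpos hocc hfac hinf, hr, ← he]
    simp
  · rintro ⟨r, hr⟩
    refine ⟨r.trans e, fun n => ?_⟩
    rw [nthReturnWord_eq hpos hocc hfac hinf, hr]
    exact (he _).symm

end Transport

/-! ### The empty prefix -/

section EmptyPrefix

variable {A B : Type*}

theorem setOf_occurs_nil (u : ℕ → A) : {i | Occurs u [] i} = Set.univ :=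
  Set.eq_univ_of_forall fun i => occurs_nil u i

theorem returnWords_nil (u : ℕ → A) : returnWords u [] = Set.range fun n => [u n] := by
  ext r
  constructor
  · rintro ⟨i, j, hij, -, -, hk, rfl⟩
    obtain rfl : j = i + 1 := by
      by_contra hne
      exact hk (i + 1) (by omega) (by omega) (occurs_nil u _)
    exact ⟨i, by simp [factor_one]⟩
  · rintro ⟨i, rfl⟩
    exact ⟨i, i + 1, by omega, occurs_nil u _, occurs_nil u _, fun k h₁ h₂ => by omega,
      by simp [factor_one]⟩

theorem nthReturnWord_nil (u : ℕ → A) (n : ℕ) : nthReturnWord u [] n = [u n] := by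
  have : Occurs u [] = fun _ => True := funext fun i => eq_true (occurs_nil u i)
  simp [nthReturnWord, this, factor_one]

/-- The return words to the empty word are the letters. -/
theorem isDerivatedWord_nil_iff {u : ℕ → A} (hu : Function.Surjective u) (x : ℕ → B) :
    IsDerivatedWord u [] x ↔ EqUpToLetters u x := by
  have hret : returnWords u [] = Set.range fun e : A => [e] := by
    rw [returnWords_nil]
    exact hu.range_comp fun e : A => [e]
  let e : A ≃ returnWords u [] :=
    (Equiv.ofInjective (fun e : A => [e]) List.singleton_injective).trans
      (Equiv.setCongr hret.symm)
  have he : ∀ a, (e a : List A) = [a] := fun a => rfl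
  constructor
  · rintro ⟨-, r, hr⟩
    refine ⟨e.trans r.symm, fun n => ?_⟩
    have : e (u n) = r (x n) := Subtype.ext (by rw [he, ← hr, nthReturnWord_nil])
    simp [this]
  · rintro ⟨π, hπ⟩
    refine ⟨by rw [setOf_occurs_nil]; exact Set.infinite_univ, π.symm.trans e, fun n => ?_⟩
    rw [nthReturnWord_nil, hπ]
    simp [he]

end EmptyPrefix

/-! ### The morphisms `block c k` and their synchronization -/

section Block

theorem add_one_ne_self (c : Fin 2) : c + 1 ≠ c := by
  fin_cases c <;> decide

theorem eq_of_ne_of_ne {c x y : Fin 2} (hx : x ≠ c) (hy : y ≠ c) : x = y := by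
  omega

/-- The morphism `c ↦ c d^k`, `d ↦ c d^{k+1}`, where `d` is the letter other than `c`. -/
def block (c : Fin 2) (k : ℕ) : Monoid.End (FreeMonoid (Fin 2)) :=
  FreeMonoid.lift fun e =>
    FreeMonoid.ofList (c :: List.replicate (if e = c then k else k + 1) (c + 1))

theorem block_of (c : Fin 2) (k : ℕ) (e : Fin 2) : block c k (FreeMonoid.of e) =
    FreeMonoid.ofList (c :: List.replicate (if e = c then k else k + 1) (c + 1)) :=
  FreeMonoid.lift_eval_of _ _

theorem mapWord_block_singleton (c : Fin 2) (k : ℕ) (e : Fin 2) :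
    mapWord (block c k) [e] = c :: List.replicate (if e = c then k else k + 1) (c + 1) :=
  congrArg FreeMonoid.toList (block_of c k e)

theorem nonerasing_block (c : Fin 2) (k : ℕ) : Nonerasing (block c k) := fun e => by
  simp [mapWord_block_singleton]

theorem mapWord_block_ne_cons (c : Fin 2) (k : ℕ) (x : List (Fin 2)) (y : List (Fin 2)) :
    mapWord (block c k) x ≠ (c + 1) :: y := by
  cases x with
  | nil => simp
  | cons e x =>
    rw [mapWord_cons, mapWord_block_singleton]
    simp [(add_one_ne_self c).symm]

/-- If the first letters differ, then after the common `c d^k` one word continues with `d`, while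
the other continues with an image, which is empty or starts with `c`. -/
theorem mapWord_block_injective (c : Fin 2) (k : ℕ) :
    Function.Injective (mapWord (block c k)) := by
  intro x
  induction x with
  | nil =>
    intro y h
    cases y with
    | nil => rfl
    | cons e y => rw [mapWord_cons, mapWord_block_singleton] at h; simp at h
  | cons e x ih =>
    intro y h
    cases y with
    | nil => rw [mapWord_cons, mapWord_block_singleton] at h; simp at h
    | cons e' y =>
      rw [mapWord_cons, mapWord_cons _ e'] at h
      by_cases he : e = c <;> by_cases he' : e' = c
      · subst he he'
        rw [ih (List.append_cancel_left h)]
      · simp only [mapWord_block_singleton, he, he', if_true, if_false, List.replicate_succ',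
          List.cons_append, List.append_assoc, List.cons.injEq, true_and,
          List.append_cancel_left_eq, List.nil_append] at h
        exact absurd h (mapWord_block_ne_cons c k _ _)
      · simp only [mapWord_block_singleton, he, he', if_true, if_false, List.replicate_succ',
          List.cons_append, List.append_assoc, List.cons.injEq, true_and,
          List.append_cancel_left_eq, List.nil_append] at h
        exact absurd h.symm (mapWord_block_ne_cons c k _ _)
      · obtain rfl := eq_of_ne_of_ne he he'
        rw [ih (List.append_cancel_left h)]

variable {c : Fin 2} {k : ℕ} {u u' : ℕ → Fin 2}

/-- The position in the image of `u'` under `block c k` where the image of `u'_m` starts. -/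
def blockPos (c : Fin 2) (k : ℕ) (u' : ℕ → Fin 2) (m : ℕ) : ℕ :=
  (mapWord (block c k) (factor u' 0 m)).length

@[simp]
theorem blockPos_zero : blockPos c k u' 0 = 0 := by
  simp [blockPos]

theorem blockPos_succ (m : ℕ) :
    blockPos c k u' (m + 1) = blockPos c k u' m + k + 1 + if u' m = c then 0 else 1 := by
  rw [blockPos, factor_add, factor_one, mapWord_append, mapWord_block_singleton]
  split_ifs <;> simp_all [blockPos] <;> omega

theorem blockPos_strictMono : StrictMono (blockPos c k u') :=
  strictMono_nat_of_lt_succ fun m => by rw [blockPos_succ]; omega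

theorem factor_blockPos (h : IsImage (block c k) u' u) {i j : ℕ} (hij : i ≤ j) :
    factor u (blockPos c k u' i) (blockPos c k u' j - blockPos c k u' i) =
      mapWord (block c k) (factor u' i (j - i)) := by
  have hP : ∀ n, factor u 0 (blockPos c k u' n) = mapWord (block c k) (factor u' 0 n) := h.1
  obtain ⟨n, rfl⟩ := Nat.exists_eq_add_of_le hij
  have h₂ := hP (i + n)
  obtain ⟨l, hl⟩ :=
    Nat.exists_eq_add_of_le (blockPos_strictMono (c := c) (k := k) (u' := u') |>.monotone hij)
  rw [hl, factor_add, factor_add, mapWord_append, ← hP i] at h₂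
  rw [hl]
  simpa using List.append_cancel_left h₂

theorem apply_blockPos_add (h : IsImage (block c k) u' u) (m : ℕ) {t : ℕ}
    (ht : t < blockPos c k u' (m + 1) - blockPos c k u' m) :
    u (blockPos c k u' m + t) = if t = 0 then c else c + 1 := by
  have h₁ := factor_blockPos h (Nat.le_add_right m 1)
  rw [Nat.add_sub_cancel_left, factor_one, mapWord_block_singleton] at h₁
  rw [← getElem_factor u (blockPos c k u' m) (blockPos c k u' (m + 1) - blockPos c k u' m) t
    (by simpa using ht), List.getElem_of_eq h₁]
  cases t <;> simp

theorem exists_blockPos_add_eq (c : Fin 2) (k : ℕ) (u' : ℕ → Fin 2) (i : ℕ) :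
    ∃ m t, i = blockPos c k u' m + t ∧ t < blockPos c k u' (m + 1) - blockPos c k u' m := by
  have hex : ∃ m, i < blockPos c k u' (m + 1) :=
    ⟨i, blockPos_strictMono.le_apply⟩
  classical
  have h₁ := Nat.find_spec hex
  have h₂ : blockPos c k u' (Nat.find hex) ≤ i := by
    rcases hn : Nat.find hex with _ | n
    · simp
    · exact not_lt.1 (Nat.find_min hex (m := n) (by omega))
  exact ⟨Nat.find hex, i - blockPos c k u' (Nat.find hex), by omega, by omega⟩

/-- A block contains `c` only as its first letter, so `u` alone determines its cutting into blocks.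
-/
theorem apply_eq_iff_exists_blockPos (h : IsImage (block c k) u' u) (i : ℕ) :
    u i = c ↔ ∃ m, blockPos c k u' m = i := by
  constructor
  · intro hi
    obtain ⟨m, t, rfl, ht⟩ := exists_blockPos_add_eq c k u' i
    rw [apply_blockPos_add h m ht] at hi
    split_ifs at hi with h0
    · exact ⟨m, by omega⟩
    · exact absurd hi (add_one_ne_self c)
  · rintro ⟨m, rfl⟩
    have := blockPos_strictMono (c := c) (k := k) (u' := u') m.lt_succ_self
    simpa using apply_blockPos_add h m (t := 0) (by simp at this; omega)

theorem apply_ne_of_lt_of_lt (h : IsImage (block c k) u' u) {m i : ℕ}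
    (h₁ : blockPos c k u' m < i) (h₂ : i < blockPos c k u' (m + 1)) : u i ≠ c := by
  intro hi
  obtain ⟨n, rfl⟩ := (apply_eq_iff_exists_blockPos h i).1 hi
  rw [blockPos_strictMono.lt_iff_lt] at h₁ h₂
  omega

/-- The letter of index `k + 1` after the start of a block determines the block. -/
theorem apply_blockPos_add_succ (h : IsImage (block c k) u' u) (m : ℕ) :
    u (blockPos c k u' m + (k + 1)) = u' m := by
  have hs := blockPos_succ (c := c) (k := k) (u' := u') m
  -- The block of `c` has length `k + 1`, so the position read is the start of the next block. The
  -- other block has length `k + 2`, and the position read is its last letter.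
  by_cases hm : u' m = c
  · rw [hm, apply_eq_iff_exists_blockPos h]
    exact ⟨m + 1, by rw [hs, if_pos hm]; omega⟩
  · rw [if_neg hm] at hs
    exact eq_of_ne_of_ne (apply_ne_of_lt_of_lt h (m := m) (by omega) (by omega)) hm

/-- The occurrences of a nonempty prefix of `u` are the positions of the occurrences of a shorter
prefix of its desubstitution `u'`. -/
theorem occurs_iff_exists_blockPos (h : IsImage (block c k) u' u) {L n : ℕ}
    (hL : ∀ s < n, blockPos c k u' s + (k + 1) < L) (hL₀ : 0 < L)
    (hL' : L ≤ blockPos c k u' n + (k + 1)) (i : ℕ) :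
    Occurs u (factor u 0 L) i ↔ ∃ m, blockPos c k u' m = i ∧ Occurs u' (factor u' 0 n) m := by
  simp only [occurs_factor_iff]
  have hc : u 0 = c := (apply_eq_iff_exists_blockPos h 0).2 ⟨0, by simp⟩
  -- Block lengths depend only on the letters, so equal factors of `u'` have blocks cut in the same
  -- way.
  have hadd : ∀ m s, (∀ t < s, u' (m + t) = u' t) →
      blockPos c k u' (m + s) = blockPos c k u' m + blockPos c k u' s := by
    intro m s
    induction s with
    | zero => simp
    | succ s ih =>
      intro hs
      rw [← add_assoc, blockPos_succ, blockPos_succ, ih fun t ht => hs t (by omega),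
        hs s (by omega)]
      omega
  constructor
  · intro hi
    obtain ⟨m, rfl⟩ := (apply_eq_iff_exists_blockPos h i).1 (by simpa [hc] using hi 0 hL₀)
    refine ⟨m, rfl, fun s => ?_⟩
    induction s using Nat.strong_induction_on with
    | _ s ih =>
      intro hs
      -- By `hL`, the letter that decides the block number `s` lies inside the prefix of length `L`;
      -- the earlier blocks are already known to agree.
      rw [← apply_blockPos_add_succ h s, ← hi _ (hL s hs), ← add_assoc,
        ← hadd m s fun t ht => ih t ht (ht.trans hs), apply_blockPos_add_succ h]
  · rintro ⟨m, rfl, hm⟩ t ht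
    obtain ⟨s, r, rfl, hr⟩ := exists_blockPos_add_eq c k u' t
    have hsn : s ≤ n := by
      by_contra hns
      have h₁ := (blockPos_strictMono (c := c) (k := k) (u' := u')).monotone
        (show n + 1 ≤ s by omega)
      rw [blockPos_succ] at h₁
      omega
    rw [← add_assoc, ← hadd m s fun t ht => hm t (by omega), apply_blockPos_add h s hr,
      apply_blockPos_add h (m + s) ?_]
    -- For `s = n` the two blocks may differ, but `hL'` keeps the offset at most `k`, inside their
    -- common prefix `c d^k`.
    rcases hsn.eq_or_lt with rfl | hsn
    · rw [blockPos_succ]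
      omega
    · rw [add_assoc m s 1, hadd m s fun t ht => hm t (by omega),
        hadd m (s + 1) fun t ht => hm t (by omega)]
      omega

/-- Here `n` counts the letters of `u'` that the prefix of length `L` determines. The strict bound
`n < L` drives the inductions on prefix length. -/
theorem exists_prefix_length (c : Fin 2) (k : ℕ) (u' : ℕ → Fin 2) {L : ℕ} (hL₀ : 0 < L) :
    ∃ n < L, (∀ s < n, blockPos c k u' s + (k + 1) < L) ∧ L ≤ blockPos c k u' n + (k + 1) := by
  have hex : ∃ n, L ≤ blockPos c k u' n + (k + 1) :=
    ⟨L, (blockPos_strictMono.le_apply).trans (Nat.le_add_right _ _)⟩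
  classical
  have hmin : ∀ s < Nat.find hex, blockPos c k u' s + (k + 1) < L := fun s hs =>
    not_le.1 (Nat.find_min hex hs)
  refine ⟨Nat.find hex, ?_, hmin, Nat.find_spec hex⟩
  rcases hn : Nat.find hex with _ | n
  · exact hL₀
  · have h₁ := hmin n (by omega)
    have h₂ := (blockPos_strictMono (c := c) (k := k) (u' := u')).le_apply (x := n)
    omega

end Block

/-! ### Correspondence between prefixes of `u` and of `u'` -/

section Desubstitution

variable {c : Fin 2} {k : ℕ} {u u' : ℕ → Fin 2}

theorem IsPrefixOf.exists_desubstitution (h : IsImage (block c k) u' u) {p : List (Fin 2)}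
    (hp : IsPrefixOf p u) (hp₀ : p ≠ []) :
    ∃ q, IsPrefixOf q u' ∧ q.length < p.length ∧
      ∀ i, Occurs u p i ↔ ∃ m, blockPos c k u' m = i ∧ Occurs u' q m := by
  have hL₀ := List.length_pos_iff.2 hp₀
  obtain ⟨n, hn, hL, hL'⟩ := exists_prefix_length c k u' hL₀
  refine ⟨factor u' 0 n, isPrefixOf_factor u' n, by simpa using hn, fun i => ?_⟩
  rw [← occurs_iff_exists_blockPos h hL hL₀ hL', show factor u 0 p.length = p from hp]

theorem IsPrefixOf.exists_substitution (h : IsImage (block c k) u' u) {q : List (Fin 2)}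
    (hq : IsPrefixOf q u') :
    ∃ p, p ≠ [] ∧ IsPrefixOf p u ∧
      ∀ i, Occurs u p i ↔ ∃ m, blockPos c k u' m = i ∧ Occurs u' q m := by
  -- This prefix is the image of `q` followed by `c d^k`, which every next block supplies; it is
  -- nonempty even when `q` is empty.
  refine ⟨factor u 0 (blockPos c k u' q.length + (k + 1)), ?_, isPrefixOf_factor u _, fun i => ?_⟩
  · rw [← List.length_pos_iff, length_factor]
    omega
  · rw [occurs_iff_exists_blockPos h (n := q.length) ?_ (by omega) le_rfl,
      show factor u' 0 q.length = q from hq]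
    exact fun s hs => Nat.add_lt_add_right (blockPos_strictMono hs) _

end Desubstitution

/-! ### Rewriting of names and the first block of a normalized name -/

section Names

theorem phi_cons (x : Name) (v : List Name) : phi (x :: v) = elementary x * phi v := by
  simp [phi]

theorem phi_append (v w : List Name) : phi (v ++ w) = phi v * phi w := by
  simp [phi]

theorem phi_singleton (x : Name) : phi [x] = elementary x := by
  simp [phi]

theorem phi_replicate (k : ℕ) (x : Name) : phi (List.replicate k x) = elementary x ^ k := by
  simp [phi]

theorem elementary_a_zero : elementary .a (FreeMonoid.of 0) = FreeMonoid.of 0 := rfl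
theorem elementary_a_one :
    elementary .a (FreeMonoid.of 1) = FreeMonoid.of 1 * FreeMonoid.of 0 := rfl
theorem elementary_b_zero : elementary .b (FreeMonoid.of 0) = FreeMonoid.of 0 := rfl
theorem elementary_b_one :
    elementary .b (FreeMonoid.of 1) = FreeMonoid.of 0 * FreeMonoid.of 1 := rfl
theorem elementary_α_zero :
    elementary .α (FreeMonoid.of 0) = FreeMonoid.of 0 * FreeMonoid.of 1 := rfl
theorem elementary_α_one : elementary .α (FreeMonoid.of 1) = FreeMonoid.of 1 := rfl
theorem elementary_β_zero :
    elementary .β (FreeMonoid.of 0) = FreeMonoid.of 1 * FreeMonoid.of 0 := rfl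
theorem elementary_β_one : elementary .β (FreeMonoid.of 1) = FreeMonoid.of 1 := rfl

theorem monoidEnd_pow_succ_apply {M : Type*} [Monoid M] (f : Monoid.End M) (k : ℕ) (x : M) :
    (f ^ (k + 1)) x = f ((f ^ k) x) := by
  rw [pow_succ']; rfl

theorem elementary_a_pow_zero (k : ℕ) :
    (elementary .a ^ k) (FreeMonoid.of 0) = FreeMonoid.of 0 := by
  induction k with
  | zero => rfl
  | succ k ih => rw [monoidEnd_pow_succ_apply, ih, elementary_a_zero]

theorem elementary_b_pow_zero (k : ℕ) :
    (elementary .b ^ k) (FreeMonoid.of 0) = FreeMonoid.of 0 := by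
  induction k with
  | zero => rfl
  | succ k ih => rw [monoidEnd_pow_succ_apply, ih, elementary_b_zero]

theorem elementary_α_pow_one (k : ℕ) :
    (elementary .α ^ k) (FreeMonoid.of 1) = FreeMonoid.of 1 := by
  induction k with
  | zero => rfl
  | succ k ih => rw [monoidEnd_pow_succ_apply, ih, elementary_α_one]

theorem elementary_β_pow_one (k : ℕ) :
    (elementary .β ^ k) (FreeMonoid.of 1) = FreeMonoid.of 1 := by
  induction k with
  | zero => rfl
  | succ k ih => rw [monoidEnd_pow_succ_apply, ih, elementary_β_one]

theorem elementary_a_pow_one (k : ℕ) :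
    (elementary .a ^ k) (FreeMonoid.of 1) = FreeMonoid.of 1 * FreeMonoid.of 0 ^ k := by
  induction k with
  | zero => rw [pow_zero, pow_zero, mul_one]; rfl
  | succ k ih =>
    rw [monoidEnd_pow_succ_apply, ih, map_mul, map_pow, elementary_a_zero, elementary_a_one,
      mul_assoc, ← pow_succ']

theorem elementary_b_pow_one (k : ℕ) :
    (elementary .b ^ k) (FreeMonoid.of 1) = FreeMonoid.of 0 ^ k * FreeMonoid.of 1 := by
  induction k with
  | zero => rw [pow_zero, pow_zero, one_mul]; rfl
  | succ k ih =>
    rw [monoidEnd_pow_succ_apply, ih, map_mul, map_pow, elementary_b_zero, elementary_b_one,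
      ← mul_assoc, ← pow_succ]

theorem elementary_α_pow_zero (k : ℕ) :
    (elementary .α ^ k) (FreeMonoid.of 0) = FreeMonoid.of 0 * FreeMonoid.of 1 ^ k := by
  induction k with
  | zero => rw [pow_zero, pow_zero, mul_one]; rfl
  | succ k ih =>
    rw [monoidEnd_pow_succ_apply, ih, map_mul, map_pow, elementary_α_zero, elementary_α_one,
      mul_assoc, ← pow_succ']

theorem elementary_β_pow_zero (k : ℕ) :
    (elementary .β ^ k) (FreeMonoid.of 0) = FreeMonoid.of 1 ^ k * FreeMonoid.of 0 := by
  induction k with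
  | zero => rw [pow_zero, pow_zero, one_mul]; rfl
  | succ k ih =>
    rw [monoidEnd_pow_succ_apply, ih, map_mul, map_pow, elementary_β_zero, elementary_β_one,
      ← mul_assoc, ← pow_succ]

/-- On each letter, both sides reduce to an instance of `1 (01)^n = (10)^n 1`. -/
theorem elementary_greek_rule (k : ℕ) :
    elementary .α * elementary .a ^ k * elementary .β =
      elementary .β * elementary .b ^ k * elementary .α := by
  refine FreeMonoid.hom_eq fun e => ?_
  fin_cases e
  · change elementary .α ((elementary .a ^ k) (elementary .β (FreeMonoid.of 0))) =
      elementary .β ((elementary .b ^ k) (elementary .α (FreeMonoid.of 0)))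
    simp only [elementary_β_zero, elementary_α_zero, map_mul, elementary_a_pow_zero,
      elementary_a_pow_one, elementary_b_pow_zero, elementary_b_pow_one, map_pow,
      elementary_α_one, elementary_β_one]
    rw [mul_assoc, ← pow_succ, ← mul_assoc, ← pow_succ', mul_pow_mul]
  · change elementary .α ((elementary .a ^ k) (elementary .β (FreeMonoid.of 1))) =
      elementary .β ((elementary .b ^ k) (elementary .α (FreeMonoid.of 1)))
    simp only [elementary_β_zero, elementary_α_zero, map_mul,
      elementary_a_pow_one, elementary_b_pow_one, map_pow,
      elementary_α_one, elementary_β_one]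
    rw [mul_pow_mul]

theorem elementary_latin_rule (k : ℕ) :
    elementary .a * elementary .α ^ k * elementary .b =
      elementary .b * elementary .β ^ k * elementary .a := by
  refine FreeMonoid.hom_eq fun e => ?_
  fin_cases e
  · change elementary .a ((elementary .α ^ k) (elementary .b (FreeMonoid.of 0))) =
      elementary .b ((elementary .β ^ k) (elementary .a (FreeMonoid.of 0)))
    simp only [elementary_b_zero, elementary_a_zero, map_mul,
      elementary_α_pow_zero, elementary_β_pow_zero, map_pow,
      elementary_a_one, elementary_b_one]
    rw [mul_pow_mul]
  · change elementary .a ((elementary .α ^ k) (elementary .b (FreeMonoid.of 1))) =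
      elementary .b ((elementary .β ^ k) (elementary .a (FreeMonoid.of 1)))
    simp only [elementary_b_one, elementary_a_one, map_mul, elementary_α_pow_zero,
      elementary_α_pow_one, elementary_β_pow_zero, elementary_β_pow_one, map_pow,
      elementary_a_zero, elementary_b_zero]
    rw [mul_assoc, ← pow_succ, ← mul_assoc, ← pow_succ', mul_pow_mul]

theorem Step.phi_eq {v w : List Name} (h : Step v w) : phi v = phi w := by
  cases h with
  | greek p s k =>
    simp only [phi_append, phi_singleton, phi_replicate, elementary_greek_rule]
  | latin p s k =>
    simp only [phi_append, phi_singleton, phi_replicate, elementary_latin_rule]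

theorem Rewrites.phi_eq {v w : List Name} (h : Rewrites v w) : phi v = phi w := by
  induction h with
  | rel x y h => exact h.phi_eq
  | refl x => rfl
  | symm x y _ ih => exact ih.symm
  | trans x y z _ _ ih₁ ih₂ => exact ih₁.trans ih₂

theorem Rewrites.mem_b_or_mem_β_iff {v w : List Name} (h : Rewrites v w) :
    (.b ∈ v ∨ .β ∈ v) ↔ (.b ∈ w ∨ .β ∈ w) := by
  induction h with
  | rel x y h => cases h <;> simp
  | refl x => rfl
  | symm x y _ ih => exact ih.symm
  | trans x y z _ _ ih₁ ih₂ => exact ih₁.trans ih₂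

theorem rewrites_normalName (w : List Name) : Rewrites w (normalName w) :=
  (normalName_spec w).1

/-- The first changed letter goes from `α` to `β` or from `a` to `b`. -/
theorem Step.lt {v w : List Name} (h : Step v w) : v < w := by
  cases h with
  | greek p s k =>
    simp only [List.append_assoc, List.singleton_append]
    exact List.append_left_lt (List.cons_lt_cons_iff.2 (Or.inl (by decide)))
  | latin p s k =>
    simp only [List.append_assoc, List.singleton_append]
    exact List.append_left_lt (List.cons_lt_cons_iff.2 (Or.inl (by decide)))

/-- Irreducibility is the only consequence of lexicographic maximality that the proof needs. -/
theorem not_step_normalName (w v : List Name) : ¬ Step (normalName w) v := fun h =>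
  h.lt.not_ge ((normalName_spec w).2
    (Relation.EqvGen.trans _ _ _ (rewrites_normalName w) (Relation.EqvGen.rel _ _ h)))

/-- Induction from the right: putting `a` before `α^k b`, or `α` before `a^k β`, would create the
left side of a rule, while the other two combinations lengthen the run. -/
theorem exists_prefix_of_irreducible {w : List Name} (hw : ∀ v, ¬ Step w v)
    (hw' : .b ∈ w ∨ .β ∈ w) :
    (∃ k w', w = List.replicate k .a ++ .β :: w') ∨
      ∃ k w', w = List.replicate k .α ++ .b :: w' := by
  induction w with
  | nil => simp at hw'
  | cons x w ih =>
    have hirr : ∀ v, ¬ Step w v := by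
      intro v hv
      cases hv with
      | greek p s k => exact hw _ (Step.greek (x :: p) s k)
      | latin p s k => exact hw _ (Step.latin (x :: p) s k)
    cases x with
    | b => exact Or.inr ⟨0, w, rfl⟩
    | β => exact Or.inl ⟨0, w, rfl⟩
    | a =>
      rcases ih hirr (by simpa using hw') with ⟨k, w', rfl⟩ | ⟨k, w', rfl⟩
      · exact Or.inl ⟨k + 1, w', rfl⟩
      · exact absurd (by simpa using Step.latin [] w' k) (hw _)
    | α =>
      rcases ih hirr (by simpa using hw') with ⟨k, w', rfl⟩ | ⟨k, w', rfl⟩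
      · exact absurd (by simpa using Step.greek [] w' k) (hw _)
      · exact Or.inr ⟨k + 1, w', rfl⟩

theorem delta_replicate_a_append (k : ℕ) (w' : List Name) :
    delta (List.replicate k .a ++ .β :: w') =
      normalName (w' ++ (List.replicate k .a ++ [.β])) := by
  have h₁ : (List.replicate k Name.a ++ .β :: w').dropWhile (· = .a) = .β :: w' := by
    rw [List.dropWhile_append_of_pos (by simp)]
    simp
  have h₂ : (List.replicate k Name.a ++ .β :: w').takeWhile (· = .a) = List.replicate k .a := by
    rw [List.takeWhile_append_of_pos (by simp)]
    simp
  rw [delta, h₁, h₂]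
  simp

theorem delta_replicate_α_append (k : ℕ) (w' : List Name) :
    delta (List.replicate k .α ++ .b :: w') =
      normalName (w' ++ (List.replicate k .α ++ [.b])) := by
  have h₁ : (List.replicate k Name.α ++ .b :: w').dropWhile (· = .α) = .b :: w' := by
    rw [List.dropWhile_append_of_pos (by simp)]
    simp
  have h₂ : (List.replicate k Name.α ++ .b :: w').takeWhile (· = .α) = List.replicate k .α := by
    rw [List.takeWhile_append_of_pos (by simp)]
    simp
  rw [delta, h₁, h₂]
  -- The first match in `delta` has to fail: the word has no leading `a`, and its first letter is
  -- `b` or `α`, not `β`.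
  cases k <;> simp [List.replicate_succ]

theorem block_of_eq_mul_pow (c : Fin 2) (k : ℕ) (e : Fin 2) : block c k (FreeMonoid.of e) =
    FreeMonoid.of c * FreeMonoid.of (c + 1) ^ (if e = c then k else k + 1) := by
  have h : ∀ n, FreeMonoid.ofList (List.replicate n (c + 1)) = FreeMonoid.of (c + 1) ^ n := by
    intro n
    induction n with
    | zero => rfl
    | succ n ih => rw [List.replicate_succ, FreeMonoid.ofList_cons, ih, pow_succ']
  rw [block_of, FreeMonoid.ofList_cons, h]

/-- The two kinds of prefix of a normalized name thus belong to one family, with the roles of `0`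
and `1` exchanged, and need only one analysis. -/
theorem phi_replicate_a_append_β (k : ℕ) :
    phi (List.replicate k .a ++ [.β]) = block 1 k := by
  rw [phi_append, phi_singleton, phi_replicate]
  refine FreeMonoid.hom_eq fun e => ?_
  refine Eq.trans ?_ (block_of_eq_mul_pow _ k e).symm
  change (elementary .a ^ k) (elementary .β (FreeMonoid.of e)) = _
  fin_cases e
  · change (elementary .a ^ k) (elementary .β (FreeMonoid.of 0)) =
      FreeMonoid.of 1 * FreeMonoid.of 0 ^ (k + 1)
    rw [elementary_β_zero, map_mul, elementary_a_pow_one, elementary_a_pow_zero, mul_assoc,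
      ← pow_succ]
  · change (elementary .a ^ k) (elementary .β (FreeMonoid.of 1)) =
      FreeMonoid.of 1 * FreeMonoid.of 0 ^ k
    rw [elementary_β_one, elementary_a_pow_one]

theorem phi_replicate_α_append_b (k : ℕ) :
    phi (List.replicate k .α ++ [.b]) = block 0 k := by
  rw [phi_append, phi_singleton, phi_replicate]
  refine FreeMonoid.hom_eq fun e => ?_
  refine Eq.trans ?_ (block_of_eq_mul_pow _ k e).symm
  change (elementary .α ^ k) (elementary .b (FreeMonoid.of e)) = _
  fin_cases e
  · change (elementary .α ^ k) (elementary .b (FreeMonoid.of 0)) =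
      FreeMonoid.of 0 * FreeMonoid.of 1 ^ k
    rw [elementary_b_zero, elementary_α_pow_zero]
  · change (elementary .α ^ k) (elementary .b (FreeMonoid.of 1)) =
      FreeMonoid.of 0 * FreeMonoid.of 1 ^ (k + 1)
    rw [elementary_b_one, map_mul, elementary_α_pow_one, elementary_α_pow_zero, mul_assoc,
      ← pow_succ]

/-- A normalized name outside `{a, α}*` starts with the name of a morphism `block c k`, and `Δ`
moves this prefix to the end. -/
theorem exists_phi_eq_block_mul {w : List Name} (hw : ∀ v, ¬ Step w v)
    (hw' : .b ∈ w ∨ .β ∈ w) :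
    ∃ c k w', phi w = block c k * phi w' ∧ phi (delta w) = phi w' * block c k ∧
      (∀ v, ¬ Step (delta w) v) ∧ (.b ∈ delta w ∨ .β ∈ delta w) := by
  rcases exists_prefix_of_irreducible hw hw' with ⟨k, w', rfl⟩ | ⟨k, w', rfl⟩
  · refine ⟨1, k, w', ?_, ?_, ?_, ?_⟩
    · rw [← phi_replicate_a_append_β, ← phi_append, List.append_assoc, List.singleton_append]
    · rw [delta_replicate_a_append, ← (rewrites_normalName _).phi_eq, phi_append,
        phi_replicate_a_append_β]
    · rw [delta_replicate_a_append]
      exact not_step_normalName _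
    · rw [delta_replicate_a_append, ← (rewrites_normalName _).mem_b_or_mem_β_iff]
      simp
  · refine ⟨0, k, w', ?_, ?_, ?_, ?_⟩
    · rw [← phi_replicate_α_append_b, ← phi_append, List.append_assoc, List.singleton_append]
    · rw [delta_replicate_α_append, ← (rewrites_normalName _).phi_eq, phi_append,
        phi_replicate_α_append_b]
    · rw [delta_replicate_α_append]
      exact not_step_normalName _
    · rw [delta_replicate_α_append, ← (rewrites_normalName _).mem_b_or_mem_β_iff]
      simp

end Names

/-! ### Primitivity and uniqueness of fixed points -/

section LetterPreserving

variable {A : Type*}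

/-- Every letter occurs in its own image. -/
def LetterPreserving (ψ : Monoid.End (FreeMonoid A)) : Prop :=
  ∀ e, e ∈ mapWord ψ [e]

theorem LetterPreserving.nonerasing {ψ : Monoid.End (FreeMonoid A)} (h : LetterPreserving ψ) :
    Nonerasing ψ := fun e => List.ne_nil_of_mem (h e)

theorem LetterPreserving.mem {ψ : Monoid.End (FreeMonoid A)} (h : LetterPreserving ψ) {e : A}
    {l : List A} (he : e ∈ l) : e ∈ mapWord ψ l :=
  mem_mapWord.2 ⟨e, he, h e⟩

theorem LetterPreserving.mul {ψ φ : Monoid.End (FreeMonoid A)} (h : LetterPreserving ψ)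
    (h' : LetterPreserving φ) : LetterPreserving (ψ * φ) := fun e => by
  rw [mapWord_mul]
  exact h.mem (h' e)

theorem letterPreserving_elementary (x : Name) : LetterPreserving (elementary x) := by
  intro e
  cases x <;> fin_cases e
  · exact List.mem_cons_self
  · exact List.mem_cons_self
  · exact List.mem_cons_self
  · exact List.mem_cons_of_mem _ List.mem_cons_self
  · exact List.mem_cons_self
  · exact List.mem_cons_self
  · exact List.mem_cons_of_mem _ List.mem_cons_self
  · exact List.mem_cons_self

theorem letterPreserving_phi (w : List Name) : LetterPreserving (phi w) := by
  induction w with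
  | nil => exact fun e => List.mem_cons_self
  | cons x w ih => rw [phi_cons]; exact (letterPreserving_elementary x).mul ih

theorem letterPreserving_block (c : Fin 2) (k : ℕ) : LetterPreserving (block c k) := by
  intro e
  rw [mapWord_block_singleton]
  by_cases he : e = c
  · simp [he]
  · simp [eq_of_ne_of_ne he (add_one_ne_self c)]

/-- In `(GF)^(n+1) = G (FG)^n F`, the word `F(b)` contains `b`, so `(FG)^n` turns it into a word
with all letters, and `G` loses none of them. -/
theorem IsPrimitive.conj {F G : Monoid.End (FreeMonoid A)} (hF : LetterPreserving F)
    (hG : LetterPreserving G) (h : IsPrimitive (F * G)) : IsPrimitive (G * F) := by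
  obtain ⟨n, -, hn⟩ := h
  refine ⟨n + 1, n.succ_pos, fun a b => ?_⟩
  have heq : (G * F) ^ (n + 1) = G * ((F * G) ^ n * F) := by
    rw [pow_succ, ← mul_assoc, mul_pow_mul, mul_assoc]
  rw [heq]
  change a ∈ mapWord (G * ((F * G) ^ n * F)) [b]
  rw [mapWord_mul, mapWord_mul]
  exact hG.mem (mem_mapWord.2 ⟨b, hF b, hn a b⟩)

theorem IsFixedPoint.surjective {ψ : Monoid.End (FreeMonoid A)} (hψ : IsPrimitive ψ) {u : ℕ → A}
    (hu : IsFixedPoint ψ u) : Function.Surjective u := by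
  obtain ⟨n, -, hn⟩ := hψ
  intro a
  obtain ⟨i, hi, rfl⟩ := List.mem_iff_getElem.1 (hn a (u 0))
  exact ⟨i, (hu.pow n).isPrefixOf_head.apply_eq i hi⟩

/-- Every letter has an image starting with `c`, so every fixed point starts with `c`. Primitivity
excludes that `c` is mapped to itself, so iteration from `c` grows. -/
theorem existsUnique_isFixedPoint_block_mul {c : Fin 2} {k : ℕ}
    {G : Monoid.End (FreeMonoid (Fin 2))} (hG : LetterPreserving G)
    (h : IsPrimitive (block c k * G)) : ∃! u, IsFixedPoint (block c k * G) u := by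
  have hhead : ∀ e, ∃ s, mapWord (block c k * G) [e] = c :: s := by
    intro e
    obtain ⟨e', l, hl⟩ := List.exists_cons_of_ne_nil (hG.nonerasing e)
    rw [mapWord_mul, hl, mapWord_cons, mapWord_block_singleton]
    exact ⟨_, rfl⟩
  obtain ⟨s, hs⟩ := hhead c
  have hs₀ : s ≠ [] := by
    rintro rfl
    obtain ⟨n, -, hn⟩ := h
    have hpow : ∀ n, mapWord ((block c k * G) ^ n) [c] = [c] := by
      intro n
      induction n with
      | zero => rfl
      | succ n ih => rw [pow_succ, mapWord_mul, hs, ih]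
    have hmem : c + 1 ∈ mapWord ((block c k * G) ^ n) [c] := hn (c + 1) c
    rw [hpow, List.mem_singleton] at hmem
    exact add_one_ne_self c hmem
  have hfix : ∀ u, IsFixedPoint (block c k * G) u → u 0 = c := by
    intro u hu
    obtain ⟨t, ht⟩ := hhead (u 0)
    have hp := IsImage.isPrefixOf_head hu
    rw [ht] at hp
    exact hp.apply_eq 0 (by simp)
  obtain ⟨u, ⟨hu, -⟩, huniq⟩ := existsUnique_isFixedPoint
    ((letterPreserving_block c k).mul hG).nonerasing hs₀ hs
  exact ⟨u, hu, fun v hv => huniq v ⟨hv, hfix v hv⟩⟩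

end LetterPreserving

/-! ### Descent along `Δ` -/

section Main

/-- An irreducible name outside `{a, α}*` of a primitive morphism. -/
structure Admissible (w : List Name) : Prop where
  not_step : ∀ v, ¬ Step w v
  mem_b_or_mem_β : .b ∈ w ∨ .β ∈ w
  isPrimitive : IsPrimitive (phi w)

variable {w : List Name}

theorem Admissible.delta (h : Admissible w) : Admissible (delta w) := by
  obtain ⟨c, k, w', hw, hd, hirr, hmem⟩ :=
    exists_phi_eq_block_mul h.not_step h.mem_b_or_mem_β
  refine ⟨hirr, hmem, ?_⟩
  rw [hd]
  exact IsPrimitive.conj (letterPreserving_block c k) (letterPreserving_phi w')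
    (hw ▸ h.isPrimitive)

theorem Admissible.iterate_delta (h : Admissible w) (j : ℕ) :
    Admissible (Sturmian.delta^[j] w) := by
  induction j with
  | zero => exact h
  | succ j ih => rw [Function.iterate_succ_apply']; exact ih.delta

theorem Admissible.existsUnique_isFixedPoint (h : Admissible w) :
    ∃! u, IsFixedPoint (phi w) u := by
  obtain ⟨c, k, w', hw, -⟩ := exists_phi_eq_block_mul h.not_step h.mem_b_or_mem_β
  rw [hw]
  exact existsUnique_isFixedPoint_block_mul (letterPreserving_phi w') (hw ▸ h.isPrimitive)

theorem Admissible.exists_desubstitution (h : Admissible w) {u : ℕ → Fin 2}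
    (hu : IsFixedPoint (phi w) u) :
    ∃ c k u', IsFixedPoint (phi (Sturmian.delta w)) u' ∧ IsImage (block c k) u' u := by
  obtain ⟨c, k, w', hw, hd, -⟩ := exists_phi_eq_block_mul h.not_step h.mem_b_or_mem_β
  rw [hw] at hu
  obtain ⟨u', hu', himg⟩ := hu.exists_conj (nonerasing_block c k)
    (letterPreserving_phi w').nonerasing
  exact ⟨c, k, u', hd ▸ hu', himg⟩

theorem Admissible.uniformlyRecurrent (h : Admissible w) {u : ℕ → Fin 2}
    (hu : IsFixedPoint (phi w) u) : UniformlyRecurrent u := by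
  intro p hp
  -- The name and the fixed point vary in the induction: each desubstitution replaces `w` by `delta
  -- w` and shortens the prefix.
  induction hn : p.length using Nat.strong_induction_on generalizing w u p with
  | _ n ih =>
    subst hn
    by_cases hp₀ : p = []
    · subst hp₀
      rw [setOf_occurs_nil, returnWords_nil]
      refine ⟨Set.infinite_univ, (Set.finite_range fun e : Fin 2 => [e]).subset ?_⟩
      rintro _ ⟨n, rfl⟩
      exact ⟨u n, rfl⟩
    · obtain ⟨c, k, u', hu', himg⟩ := h.exists_desubstitution hu
      obtain ⟨q, hq, hlen, hocc⟩ := hp.exists_desubstitution himg hp₀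
      obtain ⟨hinf, hfin⟩ := ih _ hlen h.delta hu' q hq rfl
      rw [setOf_occurs_infinite_iff blockPos_strictMono hocc,
        returnWords_eq_image blockPos_strictMono hocc fun i j hij => factor_blockPos himg hij]
      exact ⟨hinf, hfin.image _⟩

theorem Admissible.exists_iterate_delta_of_isDerivatedWord {B : Type*} {x : ℕ → B}
    (h : Admissible w) {u : ℕ → Fin 2} (hu : IsFixedPoint (phi w) u) {p : List (Fin 2)}
    (hp₀ : p ≠ []) (hp : IsPrefixOf p u) (hx : IsDerivatedWord u p x) :
    ∃ j, 1 ≤ j ∧ ∃ y, IsFixedPoint (phi (Sturmian.delta^[j] w)) y ∧ EqUpToLetters y x := by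
  induction hn : p.length using Nat.strong_induction_on generalizing w u p with
  | _ n ih =>
    subst hn
    obtain ⟨c, k, u', hu', himg⟩ := h.exists_desubstitution hu
    obtain ⟨q, hq, hlen, hocc⟩ := hp.exists_desubstitution himg hp₀
    rw [isDerivatedWord_iff (mapWord_block_injective c k) blockPos_strictMono hocc
      fun i j hij => factor_blockPos himg hij] at hx
    -- The descent stops here: the derivated word with respect to the empty prefix is `u'` up to
    -- renaming, since all letters occur in `u'`.
    by_cases hq₀ : q = []
    · subst hq₀
      exact ⟨1, le_rfl, u', hu',
        (isDerivatedWord_nil_iff (hu'.surjective h.delta.isPrimitive) x).1 hx⟩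
    · obtain ⟨j, -, y, hy, hyx⟩ := ih _ hlen h.delta hu' hq₀ hq hx rfl
      exact ⟨j + 1, by omega, y, hy, hyx⟩

theorem Admissible.exists_isDerivatedWord_of_iterate_delta {B : Type*} {x : ℕ → B}
    (h : Admissible w) {u : ℕ → Fin 2} (hu : IsFixedPoint (phi w) u) {j : ℕ} {y : ℕ → Fin 2}
    (hy : IsFixedPoint (phi (Sturmian.delta^[j + 1] w)) y) (hyx : EqUpToLetters y x) :
    ∃ p, p ≠ [] ∧ IsPrefixOf p u ∧ IsDerivatedWord u p x := by
  induction j generalizing w u with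
  | zero =>
    obtain ⟨c, k, u', hu', himg⟩ := h.exists_desubstitution hu
    -- Uniqueness identifies the given fixed point with the one obtained from `u` by desubstitution.
    obtain rfl : y = u' := h.delta.existsUnique_isFixedPoint.unique hy hu'
    obtain ⟨p, hp₀, hp, hocc⟩ := IsPrefixOf.exists_substitution himg (isPrefixOf_factor y 0)
    refine ⟨p, hp₀, hp, ?_⟩
    rw [isDerivatedWord_iff (mapWord_block_injective c k) blockPos_strictMono hocc
      fun i j hij => factor_blockPos himg hij]
    exact (isDerivatedWord_nil_iff (hu'.surjective h.delta.isPrimitive) x).2 hyx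
  | succ j ih =>
    obtain ⟨c, k, u', hu', himg⟩ := h.exists_desubstitution hu
    obtain ⟨q, -, hq, hx⟩ := ih h.delta hu' hy
    obtain ⟨p, hp₀, hp, hocc⟩ := IsPrefixOf.exists_substitution himg hq
    refine ⟨p, hp₀, hp, ?_⟩
    rwa [isDerivatedWord_iff (mapWord_block_injective c k) blockPos_strictMono hocc
      fun i j hij => factor_blockPos himg hij]

end Main

end Sturmian

theorem theorem3p3
    (ψ : Monoid.End (FreeMonoid (Fin 2)))
    (hψ : ψ ∈ Sturmian.specialSturmianMonoid)
    (hprim : Sturmian.IsPrimitive ψ)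
    (w : List Sturmian.Name)
    (hw : Sturmian.IsNormalizedName ψ w)
    (hw' : ¬ ∀ c ∈ w, c = Sturmian.Name.a ∨ c = Sturmian.Name.α) :
    (∃! u : ℕ → Fin 2, Sturmian.IsFixedPoint ψ u) ∧
    (∀ j : ℕ, 1 ≤ j →
      ∃! y : ℕ → Fin 2, Sturmian.IsFixedPoint (Sturmian.phi (Sturmian.delta^[j] w)) y) ∧
    ∀ u : ℕ → Fin 2, Sturmian.IsFixedPoint ψ u →
      Sturmian.UniformlyRecurrent u ∧
      ∀ (B : Type*) (x : ℕ → B),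
        (∃ p : List (Fin 2), p ≠ [] ∧ Sturmian.IsPrefixOf p u ∧ Sturmian.IsDerivatedWord u p x) ↔
        (∃ j : ℕ, 1 ≤ j ∧ ∃ y : ℕ → Fin 2,
          Sturmian.IsFixedPoint (Sturmian.phi (Sturmian.delta^[j] w)) y ∧
            Sturmian.EqUpToLetters y x) := by
  obtain ⟨v, rfl, rfl⟩ := hw
  -- The rules preserve the morphism, so the normalized name is itself a name of it.
  rw [(Sturmian.rewrites_normalName v).phi_eq] at hprim ⊢
  have h : Sturmian.Admissible (Sturmian.normalName v) := by
    refine ⟨Sturmian.not_step_normalName v, ?_, hprim⟩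
    push Not at hw'
    obtain ⟨c, hc, hca, hcα⟩ := hw'
    cases c
    · exact absurd rfl hca
    · exact Or.inl hc
    · exact absurd rfl hcα
    · exact Or.inr hc
  refine ⟨h.existsUnique_isFixedPoint,
    fun j _ => (h.iterate_delta j).existsUnique_isFixedPoint,
    fun u hu => ⟨h.uniformlyRecurrent hu, fun B x => ⟨?_, ?_⟩⟩⟩
  · rintro ⟨p, hp₀, hp, hx⟩
    exact h.exists_iterate_delta_of_isDerivatedWord hu hp₀ hp hx
  · rintro ⟨j, hj, y, hy, hyx⟩
    obtain ⟨j, rfl⟩ := Nat.exists_eq_add_of_le' hj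
    exact h.exists_isDerivatedWord_of_iterate_delta hu hy hyx
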